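/- Let $F=F_n$ be a free group of finite rank $n$ with basis $X=\{x_1,\dots,x_n\}$. For a subset $S\subseteq F$ and $g\in F$, let $\mathrm{Ord}_S(g)$ be the least integer $k\ge 1$ such that $g^k\in S$ if such a $k$ exists, and $0$ otherwise; the spectrum of $F$ with respect to $S$ is the set $\mathrm{Ord}_S(F)=\{\mathrm{Ord}_S(g) : g\in F\}\subseteq\mathbb{N}$. A subgroup $H\le F$ is called pure if $\{g\in F : \mathrm{Ord}_H(g)\ge 1\}=H$ (equivalently, $\mathrm{Ord}_H(F)\subseteq\{0,1\}$). In all algorithms below, elements of $F$ are given by words in $X^{\pm1}$ and finitely generated subgroups by finite lists of words that represent generators, which are part of the input. (1) There is an algorithm which, given a finitely generated subgroup $H\le F$ and elements $u,w\in F$, outputs $\mathrm{Ord}_{Hu}(w)$. (2) For every finitely generated subgroup $H\le F$ and every $u\in F$ the spectrum $\mathrm{Ord}_{Hu}(F)$ is finite, and there is an algorithm which, given $H$ and $u$, outputs this finite set. (3) Consequently, the following problems are computable for $F$, where $H$ denotes a finitely generated subgroup of $F$: - the order problem $\mathrm{OP}(F)$: given $H$ and $g\in F$, output $\mathrm{Ord}_H(g)$;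 - the torsion problem $\mathrm{TP}(F)$: given $H$ and $g\in F$, decide whether $\mathrm{Ord}_H(g)\ge 1$; - the finite spectrum problem $\mathrm{FSP}(F)$: given $H$, decide whether $\mathrm{Ord}_H(F)$ is finite and, if so, output it; - the spectrum membership problem $\mathrm{SMP}(F)$: given $H$ and $m\in\mathbb{N}$, decide whether $m\in\mathrm{Ord}_H(F)$; - the torsion-group problem $\mathrm{TGP}(F)$: given $H$, decide whether $\mathrm{Ord}_H(g)\ge 1$ for all $g\in F$, that is, whether $0\notin\mathrm{Ord}_H(F)$; - the purity problem $\mathrm{PP}(F)$: given $H$, decide whether $H$ is pure in $F$. -/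

import Mathlib

namespace RelativeOrder

section Orders

/-- The relative order of `g` in the subset `S`: the least `k ≥ 1` with `g ^ k ∈ S` if there is
one, and `0` otherwise (the infimum of the empty set of natural numbers is `0`). -/
noncomputable def relOrder {G : Type*} [Group G] (S : Set G) (g : G) : ℕ :=
  sInf {k : ℕ | 1 ≤ k ∧ g ^ k ∈ S}

/-- The spectrum of `G` with respect to the subset `S`: the set of all orders in `S` of elements
of `G`. -/
def ordSpectrum {G : Type*} [Group G] (S : Set G) : Set ℕ :=
  Set.range (relOrder S)

/-- The right coset `H u = {h * u | h ∈ H}`. -/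
def rightCoset {G : Type*} [Group G] (H : Subgroup G) (u : G) : Set G :=
  (fun h : G => h * u) '' (H : Set G)

/-- `g` is periodic with respect to `H` (a nontrivial root of `H`). -/
def IsPeriodicElt {G : Type*} [Group G] (H : Subgroup G) (g : G) : Prop :=
  1 ≤ relOrder (H : Set G) g

/-- `G` is periodic with respect to `H`: every element of `G` is. -/
def IsPeriodicGroup {G : Type*} [Group G] (H : Subgroup G) : Prop :=
  ∀ g : G, IsPeriodicElt H g

/-- `H` is pure in `G`: the set of its nontrivial roots is `H` itself. -/
def IsPure {G : Type*} [Group G] (H : Subgroup G) : Prop :=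
  {g : G | IsPeriodicElt H g} = (H : Set G)

/-- Sanity check: the order is `k ≥ 1` iff `g ^ k` is the first positive power of `g` in `S`. -/
theorem relOrder_eq_iff {G : Type*} [Group G] (S : Set G) (g : G) (k : ℕ) (hk : 1 ≤ k) :
    relOrder S g = k ↔ g ^ k ∈ S ∧ ∀ i, 1 ≤ i → i < k → g ^ i ∉ S := by
  constructor
  · intro h
    have hne : {k : ℕ | 1 ≤ k ∧ g ^ k ∈ S}.Nonempty := by
      apply Nat.nonempty_of_pos_sInf
      change 0 < relOrder S g
      omega
    have h1 := Nat.sInf_mem hne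
    change 1 ≤ relOrder S g ∧ g ^ (relOrder S g) ∈ S at h1
    rw [h] at h1
    refine ⟨h1.2, fun i hi hik hS => ?_⟩
    have h2 : relOrder S g ≤ i := Nat.sInf_le ⟨hi, hS⟩
    omega
  · rintro ⟨hS, hlt⟩
    have h2 : relOrder S g ≤ k := Nat.sInf_le ⟨hk, hS⟩
    have h1 := Nat.sInf_mem (s := {k : ℕ | 1 ≤ k ∧ g ^ k ∈ S}) ⟨k, hk, hS⟩
    change 1 ≤ relOrder S g ∧ g ^ (relOrder S g) ∈ S at h1
    by_contra hne
    exact hlt _ h1.1 (by omega) h1.2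

/-- Sanity check: the order is `0` iff no positive power of `g` lies in `S`. -/
theorem relOrder_eq_zero_iff {G : Type*} [Group G] (S : Set G) (g : G) :
    relOrder S g = 0 ↔ ∀ i, 1 ≤ i → g ^ i ∉ S := by
  constructor
  · intro h i hi hS
    have h1 := Nat.sInf_mem (s := {k : ℕ | 1 ≤ k ∧ g ^ k ∈ S}) ⟨i, hi, hS⟩
    change 1 ≤ relOrder S g ∧ _ at h1
    omega
  · intro h
    have : {k : ℕ | 1 ≤ k ∧ g ^ k ∈ S} = ∅ := by
      ext k
      simpa using h k
    unfold relOrder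
    rw [this]
    exact Nat.sInf_empty

end Orders

section Problems

/-- Group words over the alphabet `X`: the letter `(a, true)` stands for `a` and `(a, false)` for
its inverse. Words need not be reduced. -/
abbrev Word (X : Type*) : Type _ := List (X × Bool)

/-- The element of `G` that a word represents, when the letter `a` stands for `x a`. -/
def wordVal {X G : Type*} [Group G] (x : X → G) (w : Word X) : G :=
  FreeGroup.lift x (FreeGroup.mk w)

/-- The finitely generated subgroup of `G` given by a finite list of words. -/
def wordSubgroup {X G : Type*} [Group G] (x : X → G) (L : List (Word X)) : Subgroup G :=
  Subgroup.closure {g : G | ∃ w ∈ L, wordVal x w = g}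

/-- `l` is the complete output of the finite set `A`: its elements, once each, in increasing
order. -/
def ListsSet (l : List ℕ) (A : Set ℕ) : Prop :=
  l.Pairwise (· < ·) ∧ ∀ k : ℕ, k ∈ l ↔ k ∈ A

/- The algorithmic problems for a group `G` with a marking `x : X → G` by a (coded) alphabet.
Algorithms are total computable functions; elements are input as words, and finitely generated
subgroups as finite lists of words. -/

/-- There is an algorithm which computes the order of an element in a coset `H u`. -/
def CosetOrderComputable {X G : Type*} [Primcodable X] [Group G] (x : X → G) : Prop :=
  ∃ f : List (Word X) × Word X × Word X → ℕ, Computable f ∧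
    ∀ (L : List (Word X)) (u w : Word X),
      f (L, u, w) = relOrder (rightCoset (wordSubgroup x L) (wordVal x u)) (wordVal x w)

/-- There is an algorithm which outputs the (always finite) spectrum of `G` with respect to a
coset `H u`. -/
def CosetSpectrumComputable {X G : Type*} [Primcodable X] [Group G] (x : X → G) : Prop :=
  ∃ f : List (Word X) × Word X → List ℕ, Computable f ∧
    ∀ (L : List (Word X)) (u : Word X),
      ListsSet (f (L, u)) (ordSpectrum (rightCoset (wordSubgroup x L) (wordVal x u)))

/-- The order problem is computable. -/
def OrderProblem {X G : Type*} [Primcodable X] [Group G] (x : X → G) : Prop :=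
  ∃ f : List (Word X) × Word X → ℕ, Computable f ∧
    ∀ (L : List (Word X)) (w : Word X),
      f (L, w) = relOrder (wordSubgroup x L : Set G) (wordVal x w)

/-- The torsion problem is decidable: is a given element periodic with respect to `H`? -/
def TorsionProblem {X G : Type*} [Primcodable X] [Group G] (x : X → G) : Prop :=
  ComputablePred fun p : List (Word X) × Word X =>
    IsPeriodicElt (wordSubgroup x p.1) (wordVal x p.2)

/-- The finite spectrum problem is computable: decide whether the spectrum with respect to `H` is
finite and, if so, output it. -/
def FiniteSpectrumProblem {X G : Type*} [Primcodable X] [Group G] (x : X → G) : Prop :=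
  ∃ f : List (Word X) → Option (List ℕ), Computable f ∧
    ∀ L : List (Word X),
      ((ordSpectrum (wordSubgroup x L : Set G)).Finite →
        ∃ l : List ℕ, f L = some l ∧ ListsSet l (ordSpectrum (wordSubgroup x L : Set G))) ∧
      (¬ (ordSpectrum (wordSubgroup x L : Set G)).Finite → f L = none)

/-- The spectrum membership problem is decidable: does `G` have elements of order `m` in `H`? -/
def SpectrumMembershipProblem {X G : Type*} [Primcodable X] [Group G] (x : X → G) : Prop :=
  ComputablePred fun p : List (Word X) × ℕ =>
    p.2 ∈ ordSpectrum (wordSubgroup x p.1 : Set G)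

/-- The torsion-group problem is decidable: is `G` periodic with respect to `H`? -/
def TorsionGroupProblem {X G : Type*} [Primcodable X] [Group G] (x : X → G) : Prop :=
  ComputablePred fun L : List (Word X) => IsPeriodicGroup (wordSubgroup x L)

/-- The purity problem is decidable: is `H` pure in `G`? -/
def PurityProblem {X G : Type*} [Primcodable X] [Group G] (x : X → G) : Prop :=
  ComputablePred fun L : List (Word X) => IsPure (wordSubgroup x L)

end Problems

end RelativeOrder

/-!
Let `H` be generated by the words in `L`. The group `F` acts on the cosets `F ⧸ H`, and `H u` is the
set of all `g` that carry one point `y` of this Schreier graph to another point `x`. The paths with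
labels in `L` and the path with label `u⁻¹`, all starting at the base point, visit a finite set `Γ`
of points, and every reduced path between points of `Γ` stays in `Γ`.

Each element of `F` has the form `v c v⁻¹` such that all words `v cᵏ v⁻¹` with `k ≥ 1` are reduced.
If the power with exponent `k` carries `y` to `x`, then the path of `v cᵏ v⁻¹` stays in `Γ`. Hence
the points that the powers `cⁱ` reach lie in `Γ`, and the order of the element is at most the number
of points of `Γ`. Moreover, the order depends only on the finite data of how the paths labelled by
`v` and by `c` act on `Γ`, and of the first and last letters, which decide whether `v cᵏ v⁻¹` is
reduced. Deleting letters between two prefixes with equal data shortens `v` and `c` to a computable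
length, so that finitely many short words realize all orders.

Membership in `H` is decided by foldings. An action of `F` colours the vertices of the words in
question, equal colours meaning equal points, and this colouring is folded. Conversely, a folded
colouring comes from an action of `F` on the colours, because partial injections between finite sets
of colours extend to permutations. So a word represents an element of `H` exactly if it is a loop in
each folded colouring in which the words in `L` are loops, and only finitely many colourings matter.
-/

namespace RelativeOrder

open FreeGroup

section Orders

variable {G : Type*} [Group G]

theorem relOrder_congr {G' : Type*} [Group G'] {A : Set G} {A' : Set G'} {g : G} {g' : G'}
    (h : ∀ k, 1 ≤ k → (g ^ k ∈ A ↔ g' ^ k ∈ A')) : relOrder A g = relOrder A' g' :=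
  congrArg sInf (Set.ext fun k => and_congr_right (h k))

theorem pow_relOrder_mem {A : Set G} {g : G} (h : relOrder A g ≠ 0) : g ^ relOrder A g ∈ A :=
  ((relOrder_eq_iff A g _ (Nat.one_le_iff_ne_zero.2 h)).1 rfl).1

theorem relOrder_eq_one_iff {A : Set G} {g : G} : relOrder A g = 1 ↔ g ∈ A := by
  rw [relOrder_eq_iff A g 1 le_rfl, pow_one]
  exact and_iff_left fun i hi hi' => absurd hi' (by omega)

theorem rightCoset_one (H : Subgroup G) : rightCoset H 1 = (H : Set G) := by
  simp [rightCoset]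

theorem mem_rightCoset_iff {H : Subgroup G} {u g : G} : g ∈ rightCoset H u ↔ g * u⁻¹ ∈ H :=
  ⟨by rintro ⟨h, hh, rfl⟩; simpa using hh, fun h => ⟨_, h, by simp⟩⟩

theorem isPeriodicGroup_iff {H : Subgroup G} :
    IsPeriodicGroup H ↔ 0 ∉ ordSpectrum (H : Set G) := by
  simp only [IsPeriodicGroup, IsPeriodicElt, ordSpectrum, Set.mem_range, not_exists,
    Nat.one_le_iff_ne_zero, ne_eq]

theorem isPure_iff {H : Subgroup G} : IsPure H ↔ ∀ k ∈ ordSpectrum (H : Set G), k < 2 := by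
  rw [IsPure, Set.ext_iff, ordSpectrum, Set.forall_mem_range]
  refine forall_congr' fun g => ?_
  rw [Set.mem_ofPred_eq, IsPeriodicElt, ← relOrder_eq_one_iff]
  omega

variable {S : Type*} [MulAction G S] {x y : S}

theorem rightCoset_stabilizer (x : S) (u : G) :
    rightCoset (MulAction.stabilizer G x) u = {g | g • u⁻¹ • x = x} := by
  ext g
  rw [mem_rightCoset_iff, MulAction.mem_stabilizer_iff, mul_smul, Set.mem_ofPred_eq]

theorem injOn_pow_smul (g : G) :
    Set.InjOn (fun i => g ^ i • y) (Finset.Icc 1 (relOrder {h : G | h • y = x} g)) := by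
  intro i hi j hj hij
  wlog hlt : i < j generalizing i j
  · rcases (not_lt.1 hlt).eq_or_lt with h | h
    exacts [h.symm, (this hj hi hij.symm h).symm]
  set m := relOrder {h : G | h • y = x} g
  obtain ⟨hi1, -⟩ := Finset.mem_Icc.1 hi
  obtain ⟨-, hjm⟩ := Finset.mem_Icc.1 hj
  obtain ⟨hmem, hmin⟩ := (relOrder_eq_iff {h : G | h • y = x} g m (by omega)).1 rfl
  have hshorter : g ^ (m - j + i) • y = x := by
    calc g ^ (m - j + i) • y = g ^ (m - j) • g ^ i • y := by rw [pow_add, mul_smul]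
      _ = g ^ (m - j) • g ^ j • y := congrArg _ hij
      _ = g ^ m • y := by rw [← mul_smul, ← pow_add, Nat.sub_add_cancel hjm]
      _ = x := hmem
  exact absurd hshorter (hmin _ (by omega) (by omega))

end Orders

section Reductions

theorem wordVal_nil {X G : Type*} [Group G] (x : X → G) : wordVal x [] = 1 := by
  rw [wordVal, ← one_eq_mk, _root_.map_one]

variable {X G : Type*} [Primcodable X] [Group G] {x : X → G}

theorem primrecRel_mem_list {β : Type*} [Primcodable β] :
    PrimrecRel fun (l : List β) (b : β) => b ∈ l :=
  (Primrec.eq : PrimrecRel fun a b : β => a = b).exists_mem_list.of_eq fun l b => by simp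

theorem computablePred_comp {β γ : Type*} [Primcodable β] [Primcodable γ] {p : γ → Prop}
    (hp : PrimrecPred p) {f : β → γ} (hf : Computable f) : ComputablePred fun b => p (f b) :=
  ComputablePred.computable_of_manyOneReducible ⟨f, hf, fun _ => Iff.rfl⟩ hp.computablePred

theorem CosetOrderComputable.orderProblem (h : CosetOrderComputable x) : OrderProblem x := by
  obtain ⟨f, hf, hfx⟩ := h
  refine ⟨fun p => f (p.1, [], p.2),
    hf.comp (Computable.fst.pair ((Computable.const []).pair Computable.snd)), fun L w => ?_⟩
  exact (hfx L [] w).trans (by rw [wordVal_nil, rightCoset_one])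

theorem OrderProblem.torsionProblem (h : OrderProblem x) : TorsionProblem x := by
  obtain ⟨f, hf, hfx⟩ := h
  exact (computablePred_comp (Primrec.nat_le.comp (Primrec.const 1) Primrec.id) hf).of_eq
    fun p => by rw [IsPeriodicElt, ← hfx]; rfl

theorem CosetSpectrumComputable.exists_ordSpectrum_list (h : CosetSpectrumComputable x) :
    ∃ f : List (Word X) → List ℕ, Computable f ∧
      ∀ L, ListsSet (f L) (ordSpectrum (wordSubgroup x L : Set G)) := by
  obtain ⟨f, hf, hfx⟩ := h
  refine ⟨fun L => f (L, []), hf.comp (Computable.id.pair (Computable.const [])), fun L => ?_⟩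
  simpa only [wordVal_nil, rightCoset_one] using hfx L []

theorem CosetSpectrumComputable.finiteSpectrumProblem (h : CosetSpectrumComputable x) :
    FiniteSpectrumProblem x := by
  obtain ⟨f, hf, hfx⟩ := h.exists_ordSpectrum_list
  refine ⟨fun L => some (f L), Computable.option_some.comp hf, fun L =>
    ⟨fun _ => ⟨_, rfl, hfx L⟩, fun hinf => absurd ?_ hinf⟩⟩
  exact (f L).finite_toSet.subset fun k hk => ((hfx L).2 k).2 hk

theorem CosetSpectrumComputable.spectrumMembershipProblem (h : CosetSpectrumComputable x) :
    SpectrumMembershipProblem x := by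
  obtain ⟨f, hf, hfx⟩ := h.exists_ordSpectrum_list
  exact (computablePred_comp primrecRel_mem_list
    ((hf.comp Computable.fst).pair Computable.snd)).of_eq fun p => (hfx p.1).2 p.2

theorem CosetSpectrumComputable.torsionGroupProblem (h : CosetSpectrumComputable x) :
    TorsionGroupProblem x := by
  obtain ⟨f, hf, hfx⟩ := h.exists_ordSpectrum_list
  exact (computablePred_comp (primrecRel_mem_list.comp Primrec.id (Primrec.const 0)).not
    hf).of_eq fun L => by rw [isPeriodicGroup_iff, ← (hfx L).2 0]; rfl

theorem CosetSpectrumComputable.purityProblem (h : CosetSpectrumComputable x) :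
    PurityProblem x := by
  obtain ⟨f, hf, hfx⟩ := h.exists_ordSpectrum_list
  have hlt : PrimrecPred fun k : ℕ => k < 2 := Primrec.nat_lt.comp Primrec.id (Primrec.const 2)
  exact (computablePred_comp hlt.forall_mem_list hf).of_eq fun L => by
    simp only [isPure_iff, (hfx L).2]

end Reductions

section Paths

variable {α S : Type*} [MulAction (FreeGroup α) S] {Γ : Set S} {v w : Word α} {p : S}

theorem mk_append_smul (v w : Word α) (p : S) : mk (v ++ w) • p = mk v • mk w • p := by
  rw [← mul_mk, mul_smul]

theorem mk_nil_smul (p : S) : mk ([] : Word α) • p = p := by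
  rw [← one_eq_mk, one_smul]

/-- In the Schreier graph of an action of a free group, the path that starts at `p` and reads the
letters of `w` from right to left only visits points of `Γ`. -/
def PathIn (Γ : Set S) (w : Word α) (p : S) : Prop :=
  ∀ s, s <:+ w → mk s • p ∈ Γ

theorem PathIn.end_mem (h : PathIn Γ w p) : mk w • p ∈ Γ :=
  h w List.suffix_rfl

theorem PathIn.start_mem (h : PathIn Γ w p) : p ∈ Γ := by
  simpa only [mk_nil_smul] using h [] (List.nil_suffix)

theorem pathIn_nil : PathIn Γ ([] : Word α) p ↔ p ∈ Γ := by
  simp only [PathIn, List.suffix_nil, forall_eq, mk_nil_smul]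

theorem pathIn_cons {a : α × Bool} : PathIn Γ (a :: w) p ↔ mk (a :: w) • p ∈ Γ ∧ PathIn Γ w p := by
  simp only [PathIn, List.suffix_cons_iff, or_imp, forall_and, forall_eq]

theorem pathIn_append : PathIn Γ (v ++ w) p ↔ PathIn Γ w p ∧ PathIn Γ v (mk w • p) := by
  induction v with
  | nil => rw [List.nil_append, pathIn_nil, and_iff_left_of_imp PathIn.end_mem]
  | cons a v ih =>
    rw [List.cons_append, pathIn_cons, pathIn_cons, ih, ← mk_append_smul, List.cons_append,
      and_left_comm]

theorem PathIn.red (h : PathIn Γ v p) (hvw : Red v w) : PathIn Γ w p := by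
  induction hvw with
  | refl => exact h
  | tail _ hstep ih =>
    obtain @⟨v₁, v₂, a, b⟩ := hstep
    have hcancel : mk ((a, b) :: (a, !b) :: v₂) = mk v₂ := Quot.sound Red.Step.cons_not
    rw [pathIn_append, hcancel, pathIn_cons, pathIn_cons] at ih
    exact pathIn_append.2 ⟨ih.1.2.2, ih.2⟩

theorem PathIn.of_mk_eq (h : PathIn Γ v p) (hvw : mk v = mk w) (hw : IsReduced w) :
    PathIn Γ w p := by
  classical
  rw [← hw.reduce_eq, ← reduce.sound hvw]
  exact h.red reduce.red

theorem PathIn.invRev (h : PathIn Γ w p) : PathIn Γ (invRev w) (mk w • p) := by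
  induction w with
  | nil => rwa [mk_nil_smul]
  | cons a w ih =>
    have hback : mk [(a.1, !a.2)] • mk (a :: w) • p = mk w • p := by
      rw [← mk_append_smul]
      exact congrArg (· • p) (Quot.sound Red.Step.cons_not_rev)
    have hinv : FreeGroup.invRev (a :: w) = FreeGroup.invRev w ++ [(a.1, !a.2)] := by
      simp [FreeGroup.invRev]
    obtain ⟨hend, hw⟩ := pathIn_cons.1 h
    rw [hinv, pathIn_append, pathIn_cons, pathIn_nil, hback]
    exact ⟨⟨hw.end_mem, hend⟩, ih hw⟩

/-- A set of points of a Schreier graph is convex if it contains every reduced path between two of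
its points. -/
def IsPathConvex (α : Type*) {S : Type*} [MulAction (FreeGroup α) S] (Γ : Set S) : Prop :=
  ∀ (w : Word α) (p : S), IsReduced w → p ∈ Γ → mk w • p ∈ Γ → PathIn Γ w p

end Paths

section PathPoints

variable {α S : Type*} [MulAction (FreeGroup α) S] {x₀ : S} {L W : List (Word α)} {s t w : Word α}

/-- The suffixes of the words in `W`. The empty word is always among them: as labels of paths that
start at a common point, the suffixes label the visited points, and the empty word labels the
start. -/
def suffixes (W : List (Word α)) : List (Word α) :=
  [] :: W.flatMap List.tails

theorem mem_suffixes : s ∈ suffixes W ↔ s = [] ∨ ∃ w ∈ W, s <:+ w := by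
  simp only [suffixes, List.mem_cons, List.mem_flatMap, List.mem_tails]

theorem nil_mem_suffixes : [] ∈ suffixes W :=
  List.mem_cons_self

theorem subset_suffixes : W ⊆ suffixes W :=
  fun w hw => mem_suffixes.2 (Or.inr ⟨w, hw, List.suffix_rfl⟩)

theorem mem_suffixes_of_suffix (hs : s ∈ suffixes W) (hts : t <:+ s) : t ∈ suffixes W := by
  rcases mem_suffixes.1 hs with rfl | ⟨w, hw, hsw⟩
  · rwa [List.suffix_nil.1 hts]
  · exact mem_suffixes.2 (Or.inr ⟨w, hw, hts.trans hsw⟩)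

open Classical in
/-- The points on the paths that start at `x₀` and are labelled by the words in `W`. -/
noncomputable def pathPoints (x₀ : S) (W : List (Word α)) : Finset S :=
  ((suffixes W).map fun s => mk s • x₀).toFinset

theorem mem_pathPoints {p : S} : p ∈ pathPoints x₀ W ↔ ∃ s ∈ suffixes W, mk s • x₀ = p := by
  simp only [pathPoints, List.mem_toFinset, List.mem_map]

theorem card_pathPoints_le (x₀ : S) (W : List (Word α)) :
    (pathPoints x₀ W).card ≤ (suffixes W).length := by
  classical
  exact (List.toFinset_card_le _).trans_eq (List.length_map _)

theorem pathIn_pathPoints (hs : s ∈ suffixes W) : PathIn (pathPoints x₀ W : Set S) s x₀ :=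
  fun t hts => mem_pathPoints.2 ⟨t, mem_suffixes_of_suffix hs hts, rfl⟩

theorem wordVal_of (w : Word α) : wordVal of w = mk w := by
  rw [wordVal, lift_of_eq_id, MonoidHom.id_apply]

theorem mk_mem_wordSubgroup (hw : w ∈ L) : mk w ∈ wordSubgroup of L :=
  Subgroup.subset_closure ⟨w, hw, wordVal_of w⟩

theorem exists_pathIn_of_mem_wordSubgroup (hx₀ : wordSubgroup of L ≤ MulAction.stabilizer _ x₀)
    (hLW : L ⊆ W) {g : FreeGroup α} (hg : g ∈ wordSubgroup of L) :
    ∃ w, mk w = g ∧ PathIn (pathPoints x₀ W : Set S) w x₀ := by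
  induction hg using Subgroup.closure_induction with
  | mem g hg =>
    obtain ⟨w, hw, rfl⟩ := hg
    exact ⟨w, (wordVal_of w).symm, pathIn_pathPoints (subset_suffixes (hLW hw))⟩
  | one => exact ⟨[], rfl, pathIn_pathPoints nil_mem_suffixes⟩
  | mul g g' hg hg' ih ih' =>
    obtain ⟨w, rfl, hw⟩ := ih
    obtain ⟨w', rfl, hw'⟩ := ih'
    refine ⟨w ++ w', mul_mk.symm, pathIn_append.2 ⟨hw', ?_⟩⟩
    rwa [show mk w' • x₀ = x₀ from hx₀ hg']
  | inv g hg ih =>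
    obtain ⟨w, rfl, hw⟩ := ih
    have hinv := hw.invRev
    rw [show mk w • x₀ = x₀ from hx₀ hg] at hinv
    exact ⟨invRev w, inv_mk.symm, hinv⟩

/-- A reduced path between two points of `pathPoints x₀ W` differs from a path back to `x₀`, a loop
at `x₀` and a path out again, all inside `pathPoints x₀ W`, by free reduction only. -/
theorem isPathConvex_pathPoints (hx₀ : MulAction.stabilizer _ x₀ = wordSubgroup of L)
    (hLW : L ⊆ W) : IsPathConvex α (pathPoints x₀ W : Set S) := by
  intro w p hw hp hq
  obtain ⟨s, hs, rfl⟩ := mem_pathPoints.1 hp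
  obtain ⟨t, ht, hst⟩ := mem_pathPoints.1 hq
  have hloop : (mk t)⁻¹ * (mk w * mk s) ∈ wordSubgroup of L := by
    rw [← hx₀, MulAction.mem_stabilizer_iff, mul_smul, mul_smul, inv_smul_eq_iff, hst]
  obtain ⟨l, hl, hlΓ⟩ := exists_pathIn_of_mem_wordSubgroup hx₀.ge hLW hloop
  have hlx₀ : mk l • x₀ = x₀ := hx₀.ge (hl ▸ hloop)
  have hback : mk (invRev s) • mk s • x₀ = x₀ := by rw [← inv_mk, inv_smul_smul]
  have hpath : PathIn (pathPoints x₀ W : Set S) (t ++ (l ++ invRev s)) (mk s • x₀) := by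
    rw [pathIn_append, pathIn_append, mk_append_smul, hback, hlx₀]
    exact ⟨⟨(pathIn_pathPoints hs).invRev, hlΓ⟩, pathIn_pathPoints ht⟩
  refine hpath.of_mk_eq ?_ hw
  rw [← mul_mk, ← mul_mk, hl, ← inv_mk]
  group

end PathPoints

section CyclicForm

variable {α : Type*}

/-- The word `v cᵏ v⁻¹`. Every element of a free group is represented by `v c v⁻¹` for some `v` and
`c` such that all these words are reduced. -/
def conjPow (v c : Word α) (k : ℕ) : Word α :=
  v ++ ((List.replicate k c).flatten ++ invRev v)

theorem mk_flatten_replicate (c : Word α) (k : ℕ) : mk (List.replicate k c).flatten = mk c ^ k := by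
  induction k with
  | zero => rfl
  | succ k ih => rw [List.replicate_succ, List.flatten_cons, ← mul_mk, ih, pow_succ']

theorem mk_conjPow (v c : Word α) (k : ℕ) : mk (conjPow v c k) = mk v * (mk c ^ k * (mk v)⁻¹) := by
  rw [conjPow, ← mul_mk, ← mul_mk, mk_flatten_replicate, inv_mk]

theorem mk_conjPow_one_pow (v c : Word α) (k : ℕ) :
    mk (conjPow v c 1) ^ k = mk (conjPow v c k) := by
  simp only [mk_conjPow, ← mul_assoc, conj_pow, pow_one]

theorem exists_conjPow (g : FreeGroup α) :
    ∃ v c : Word α, mk (conjPow v c 1) = g ∧ ∀ k, 1 ≤ k → IsReduced (conjPow v c k) := by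
  classical
  have hconj := reduceCyclically.conj_conjugator_reduceCyclically g.toWord
  refine ⟨reduceCyclically.conjugator g.toWord, reduceCyclically g.toWord, ?_, fun k hk => ?_⟩
  · rw [conjPow, List.replicate_one, List.flatten_singleton, ← List.append_assoc, hconj, mk_toWord]
  · rw [conjPow, ← List.append_assoc]
    exact IsReduced.append_flatten_replicate_append
      (reduceCyclically.isCyclicallyReduced isReduced_toWord)
      (by rw [hconj]; exact isReduced_toWord) (Nat.one_le_iff_ne_zero.1 hk)

variable {S : Type*} [MulAction (FreeGroup α) S] {Γ : Finset S} {x y : S}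

theorem relOrder_le_card (hΓ : IsPathConvex α (Γ : Set S)) (hx : x ∈ Γ) (hy : y ∈ Γ)
    (g : FreeGroup α) : relOrder {h : FreeGroup α | h • y = x} g ≤ Γ.card := by
  obtain ⟨v, c, rfl, hred⟩ := exists_conjPow g
  set m := relOrder {h : FreeGroup α | h • y = x} (mk (conjPow v c 1))
  rcases Nat.eq_zero_or_pos m with hm0 | hmpos
  · exact hm0 ▸ Nat.zero_le _
  have hmem : mk (conjPow v c m) • y = x := by
    rw [← mk_conjPow_one_pow]
    exact pow_relOrder_mem hmpos.ne'
  have hpath : PathIn (Γ : Set S) (List.replicate m c).flatten (mk (invRev v) • y) := by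
    have hreduced := hΓ _ y (hred m hmpos) hy (by rwa [hmem])
    rw [conjPow, pathIn_append, pathIn_append] at hreduced
    exact hreduced.1.2
  have hmaps : ∀ i ∈ Finset.Icc 1 m, mk c ^ i • mk (invRev v) • y ∈ Γ := by
    intro i hi
    obtain ⟨j, hj⟩ := Nat.exists_eq_add_of_le' (Finset.mem_Icc.1 hi).2
    rw [hj, List.replicate_add, List.flatten_append, pathIn_append] at hpath
    simpa only [mk_flatten_replicate, Finset.mem_coe] using hpath.1.end_mem
  have hconj : ∀ k, mk (conjPow v c 1) ^ k • y = mk v • mk c ^ k • mk (invRev v) • y := fun k => by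
    rw [mk_conjPow_one_pow, mk_conjPow, mul_smul, mul_smul, inv_mk]
  have hinj : Set.InjOn (fun i => mk c ^ i • mk (invRev v) • y) (Finset.Icc 1 m) := by
    refine fun i hi j hj hij => injOn_pow_smul (mk (conjPow v c 1)) hi hj ?_
    simpa only [hconj] using congrArg (mk v • ·) hij
  simpa only [Nat.card_Icc, Nat.add_sub_cancel] using Finset.card_le_card_of_injOn _ hmaps hinj

end CyclicForm

section Signature

variable {α S : Type*} [MulAction (FreeGroup α) S] {Γ : Finset S} {v v' w w' : Word α}

/-- The relation between the points of `Γ` that are joined by a path inside `Γ` with label `w`. -/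
def trace (Γ : Finset S) (w : Word α) (p q : Γ) : Prop :=
  PathIn (Γ : Set S) w (p : S) ∧ mk w • (p : S) = q

theorem trace_append {p q : Γ} :
    trace Γ (v ++ w) p q ↔ ∃ r, trace Γ w p r ∧ trace Γ v r q := by
  simp only [trace, pathIn_append, mk_append_smul]
  constructor
  · rintro ⟨⟨hw, hv⟩, hq⟩
    exact ⟨⟨_, hw.end_mem⟩, ⟨hw, rfl⟩, hv, hq⟩
  · rintro ⟨r, ⟨hw, hr⟩, hv, hq⟩
    rw [hr]
    exact ⟨⟨hw, hv⟩, hq⟩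

theorem trace.invRev {p q : Γ} (h : trace Γ w p q) : trace Γ (invRev w) q p := by
  obtain ⟨hpath, hq⟩ := h
  refine ⟨hq ▸ hpath.invRev, ?_⟩
  rw [← inv_mk, inv_smul_eq_iff, hq]

theorem trace_invRev {p q : Γ} : trace Γ (invRev w) p q ↔ trace Γ w q p :=
  ⟨fun h => by simpa only [invRev_invRev] using h.invRev, trace.invRev⟩

theorem trace_iff_of_isReduced (hΓ : IsPathConvex α (Γ : Set S)) (hw : IsReduced w) {p q : Γ} :
    trace Γ w p q ↔ mk w • (p : S) = q :=
  and_iff_right_of_imp fun h => hΓ w p hw p.2 (by rw [h]; exact q.2)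

theorem isReduced_append :
    IsReduced (v ++ w) ↔ IsReduced v ∧ IsReduced w ∧
      ∀ a ∈ v.getLast?, ∀ b ∈ w.head?, a.1 = b.1 → a.2 = b.2 :=
  List.isChain_append

theorem isReduced_invRev : IsReduced (invRev w) ↔ IsReduced w := by
  classical
  rw [isReduced_iff_reduce_eq, isReduced_iff_reduce_eq, reduce_invRev, invRev_injective.eq_iff]

/-- The part of the information about the word `w` that determines how the reduced words composed
of `w` and other words act on `Γ`. Both end letters matter for whether a product is reduced. -/
def signature (Γ : Finset S) (w : Word α) :
    (Γ → Γ → Prop) × Option (α × Bool) × Option (α × Bool) × Prop :=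
  (trace Γ w, w.head?, w.getLast?, IsReduced w)

theorem signature_append (hv : signature Γ v = signature Γ v')
    (hw : signature Γ w = signature Γ w') : signature Γ (v ++ w) = signature Γ (v' ++ w') := by
  simp only [signature, Prod.mk.injEq] at hv hw ⊢
  obtain ⟨hvt, hvh, hvl, hvr⟩ := hv
  obtain ⟨hwt, hwh, hwl, hwr⟩ := hw
  refine ⟨?_, ?_, ?_, ?_⟩
  · funext p q
    rw [trace_append, trace_append, hvt, hwt]
  · rw [List.head?_append, List.head?_append, hvh, hwh]
  · rw [List.getLast?_append, List.getLast?_append, hvl, hwl]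
  · rw [isReduced_append, isReduced_append, hvr, hwr, hvl, hwh]

theorem signature_invRev (h : signature Γ v = signature Γ v') :
    signature Γ (invRev v) = signature Γ (invRev v') := by
  simp only [signature, Prod.mk.injEq] at h ⊢
  obtain ⟨ht, hh, hl, hr⟩ := h
  refine ⟨?_, ?_, ?_, ?_⟩
  · funext p q
    rw [trace_invRev, trace_invRev, ht]
  · simp only [invRev, List.head?_reverse, List.getLast?_map, hl]
  · simp only [invRev, List.getLast?_reverse, List.head?_map, hh]
  · rw [isReduced_invRev, isReduced_invRev, hr]

theorem signature_flatten_replicate (h : signature Γ v = signature Γ v') (k : ℕ) :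
    signature Γ (List.replicate k v).flatten = signature Γ (List.replicate k v').flatten := by
  induction k with
  | zero => rfl
  | succ k ih =>
    rw [List.replicate_succ, List.replicate_succ, List.flatten_cons, List.flatten_cons]
    exact signature_append h ih

theorem signature_conjPow (hv : signature Γ v = signature Γ v')
    (hw : signature Γ w = signature Γ w') (k : ℕ) :
    signature Γ (conjPow v w k) = signature Γ (conjPow v' w' k) :=
  signature_append hv (signature_append (signature_flatten_replicate hw k) (signature_invRev hv))

/-- Between two prefixes of `w` with the same value of `f`, the letters can be cut out. -/
theorem exists_sublist_length_lt_card {β γ : Type*} {f : List β → γ}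
    (hf : ∀ v v' w, f v = f v' → f (v ++ w) = f (v' ++ w)) (T : Finset γ) (w : List β)
    (hT : ∀ v, v.Sublist w → f v ∈ T) :
    ∃ w', w'.Sublist w ∧ f w' = f w ∧ w'.length < T.card := by
  induction hn : w.length using Nat.strong_induction_on generalizing w with
  | _ n ih =>
    rcases lt_or_ge w.length T.card with hlt | hge
    · exact ⟨w, .refl w, rfl, hlt⟩
    obtain ⟨i, hi, j, hj, hij, heq⟩ := Finset.exists_ne_map_eq_of_card_lt_of_maps_to
      (s := Finset.range (w.length + 1)) (f := fun i => f (w.take i))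
      (by rw [Finset.card_range]; omega) (fun i _ => hT _ (List.take_sublist i w))
    wlog hlt : i < j generalizing i j
    · exact this j hj i hi hij.symm heq.symm (by omega)
    have hsub : (w.take i ++ w.drop j).Sublist w := by
      conv_rhs => rw [← List.take_append_drop i w]
      exact (List.Sublist.refl _).append (List.drop_sublist_drop_left w hlt.le)
    have hcut : f (w.take i ++ w.drop j) = f w := by
      conv_rhs => rw [← List.take_append_drop j w]
      exact hf _ _ _ heq
    have hlength : (w.take i ++ w.drop j).length < n := by
      rw [Finset.mem_range] at hi hj
      rw [List.length_append, List.length_take, List.length_drop]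
      omega
    obtain ⟨w', hw', hfw', hcard⟩ := ih _ hlength _ (fun v hv => hT v (hv.trans hsub)) rfl
    exact ⟨w', hw'.trans hsub, hfw'.trans hcut, hcard⟩

/-- An upper bound for the number of signatures of words in `M` letters on a set of `N` points. -/
def signatureBound (N M : ℕ) : ℕ :=
  2 ^ (N * N) * ((M + 1) * ((M + 1) * 2))

theorem exists_short_signature_eq (Γ : Finset S) {B : List (α × Bool)} (hw : w ⊆ B) :
    ∃ w', w' ⊆ B ∧ signature Γ w' = signature Γ w ∧
      w'.length < signatureBound Γ.card B.length := by
  classical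
  let T : Finset ((Γ → Γ → Prop) × Option (α × Bool) × Option (α × Bool) × Prop) :=
    .univ ×ˢ B.toFinset.insertNone ×ˢ B.toFinset.insertNone ×ˢ .univ
  have hT : ∀ v, v.Sublist w → signature Γ v ∈ T := fun v hv => by
    have hvB : ∀ a ∈ v, a ∈ B.toFinset := fun a ha => List.mem_toFinset.2 (hw (hv.subset ha))
    simp only [T, signature, Finset.mem_product, Finset.mem_univ, true_and, and_true,
      Finset.mem_insertNone]
    exact ⟨fun a ha => hvB a (List.mem_of_head? ha),
      fun a ha => hvB a (List.mem_of_getLast? ha)⟩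
  have hcard : T.card ≤ signatureBound Γ.card B.length := by
    simp only [T, signatureBound, Finset.card_product, Finset.card_univ, Fintype.card_fun,
      Fintype.card_prop, Fintype.card_coe, Finset.card_insertNone, ← pow_mul]
    gcongr <;> exact List.toFinset_card_le B
  obtain ⟨w', hw', hsig, hlt⟩ := exists_sublist_length_lt_card
    (fun v v' w h => signature_append (w := w) h rfl) T w hT
  exact ⟨w', fun a ha => hw (hw'.subset ha), hsig, hlt.trans_le hcard⟩

theorem invRev_subset {B : List (α × Bool)} (hB : invRev B ⊆ B) (hw : w ⊆ B) : invRev w ⊆ B :=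
  fun a ha => hB (by
    simp only [invRev, List.mem_reverse, List.mem_map] at ha ⊢
    exact ha.imp fun b hb => hb.imp_left (hw ·))

theorem exists_short_relOrder_eq (hΓ : IsPathConvex α (Γ : Set S)) {x y : S} (hx : x ∈ Γ)
    (hy : y ∈ Γ) {c : Word α} (hred : ∀ k, 1 ≤ k → IsReduced (conjPow v c k))
    {B : List (α × Bool)} (hB : invRev B ⊆ B) (hv : v ⊆ B) (hc : c ⊆ B) :
    ∃ w, w ⊆ B ∧ w.length ≤ 3 * signatureBound Γ.card B.length ∧
      relOrder {h : FreeGroup α | h • y = x} (mk w) =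
        relOrder {h : FreeGroup α | h • y = x} (mk (conjPow v c 1)) := by
  obtain ⟨v', hv', hvsig, hvlen⟩ := exists_short_signature_eq Γ hv
  obtain ⟨c', hc', hcsig, hclen⟩ := exists_short_signature_eq Γ hc
  refine ⟨conjPow v' c' 1, ?_, ?_, relOrder_congr fun k hk => ?_⟩
  · simpa [conjPow] using ⟨hv', hc', invRev_subset hB hv'⟩
  · simp only [conjPow, List.replicate_one, List.flatten_singleton, List.length_append,
      invRev_length]
    omega
  · have hsig := signature_conjPow hvsig hcsig k
    simp only [signature, Prod.mk.injEq] at hsig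
    obtain ⟨htrace, -, -, hred'⟩ := hsig
    have hiff := trace_iff_of_isReduced hΓ (hred k hk) (p := ⟨y, hy⟩) (q := ⟨x, hx⟩)
    have hiff' := trace_iff_of_isReduced hΓ (hred' ▸ hred k hk) (p := ⟨y, hy⟩) (q := ⟨x, hx⟩)
    rw [mk_conjPow_one_pow, mk_conjPow_one_pow, Set.mem_ofPred_eq, Set.mem_ofPred_eq]
    exact hiff'.symm.trans (htrace ▸ hiff)

end Signature

section Letters

variable {α : Type*} {W : List (Word α)} {w : Word α}

/-- The letters that occur in the words in `W`, and their inverses. -/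
def letters (W : List (Word α)) : List (α × Bool) :=
  W.flatten ++ invRev W.flatten

theorem invRev_letters_subset (W : List (Word α)) : invRev (letters W) ⊆ letters W := by
  simp [letters, invRev, Function.comp_def]

theorem inv_mem_letters {i : α} {b : Bool} (h : (i, b) ∈ letters W) : (i, !b) ∈ letters W :=
  invRev_letters_subset W (by simpa [invRev] using h)

theorem toWord_subset_letters [DecidableEq α] {g : FreeGroup α} (hg : g ∈ wordSubgroup of W) :
    g.toWord ⊆ letters W := by
  induction hg using Subgroup.closure_induction with
  | mem g hg =>
    obtain ⟨w, hw, rfl⟩ := hg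
    rw [wordVal_of, toWord_mk]
    exact fun a ha => List.mem_append_left _
      (List.mem_flatten.2 ⟨w, hw, reduce.red.sublist.subset ha⟩)
  | one => exact List.nil_subset _
  | mul g g' _ _ ih ih' =>
    exact List.Subset.trans (toWord_mul_sublist g g').subset (List.append_subset.2 ⟨ih, ih'⟩)
  | inv g _ ih =>
    rw [toWord_inv]
    exact invRev_subset (invRev_letters_subset W) ih

theorem rightCoset_subset_wordSubgroup (L : List (Word α)) (u : Word α) :
    rightCoset (wordSubgroup of L) (mk u) ⊆ wordSubgroup of (invRev u :: L) := by
  rintro _ ⟨h, hh, rfl⟩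
  have hle : wordSubgroup of L ≤ wordSubgroup of (invRev u :: L) :=
    Subgroup.closure_mono fun g ⟨w, hw, hg⟩ => ⟨w, List.mem_cons_of_mem _ hw, hg⟩
  refine mul_mem (hle hh) ?_
  rw [← inv_mem_iff, inv_mk]
  exact mk_mem_wordSubgroup List.mem_cons_self

theorem subset_letters_of_mem_wordSubgroup (hw : IsReduced w) (h : mk w ∈ wordSubgroup of W) :
    w ⊆ letters W := by
  classical
  simpa only [toWord_mk, hw.reduce_eq] using toWord_subset_letters h

end Letters

section ListsUpTo

variable {β : Type*} {B l : List β} {k : ℕ}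

/-- All lists of length at most `k` with entries in `B`. -/
def listsUpTo (B : List β) : ℕ → List (List β)
  | 0 => [[]]
  | k + 1 => [] :: B.flatMap fun b => (listsUpTo B k).map (b :: ·)

theorem mem_listsUpTo : l ∈ listsUpTo B k ↔ l.length ≤ k ∧ l ⊆ B := by
  induction k generalizing l with
  | zero =>
    rw [listsUpTo, List.mem_singleton, Nat.le_zero, List.length_eq_zero_iff,
      and_iff_left_of_imp]
    exact fun h => h ▸ List.nil_subset B
  | succ k ih =>
    cases l with
    | nil => simp [listsUpTo]
    | cons b l =>
      simp only [listsUpTo, List.mem_cons, reduceCtorEq, false_or, List.mem_flatMap, List.mem_map,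
        List.cons.injEq, ih, List.length_cons, Nat.add_le_add_iff_right, List.cons_subset]
      grind

end ListsUpTo

section CosetOrders

variable {α : Type*} {W : List (Word α)} {v c : Word α} {i : α}

theorem exists_convex_finset (L : List (Word α)) (u : Word α) :
    ∃ (Γ : Finset (FreeGroup α ⧸ wordSubgroup of L)) (x y : FreeGroup α ⧸ wordSubgroup of L),
      IsPathConvex α (Γ : Set (FreeGroup α ⧸ wordSubgroup of L)) ∧ x ∈ Γ ∧ y ∈ Γ ∧
      Γ.card ≤ (suffixes (invRev u :: L)).length ∧
      rightCoset (wordSubgroup of L) (mk u) = {g | g • y = x} := by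
  have hstab := MulAction.stabilizer_quotient (wordSubgroup of L)
  refine ⟨pathPoints ((1 : FreeGroup α) : FreeGroup α ⧸ wordSubgroup of L) (invRev u :: L), _, _,
    isPathConvex_pathPoints hstab (List.subset_cons_self _ _),
    (pathIn_pathPoints nil_mem_suffixes).start_mem,
    (pathIn_pathPoints (subset_suffixes List.mem_cons_self)).end_mem, card_pathPoints_le _ _, ?_⟩
  rw [← inv_mk, ← rightCoset_stabilizer, hstab]

theorem relOrder_rightCoset_le (L : List (Word α)) (u : Word α) (g : FreeGroup α) :
    relOrder (rightCoset (wordSubgroup of L) (mk u)) g ≤ (suffixes (invRev u :: L)).length := by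
  obtain ⟨Γ, x, y, hΓ, hx, hy, hcard, hcoset⟩ := exists_convex_finset L u
  exact hcoset ▸ (relOrder_le_card hΓ hx hy g).trans hcard

theorem exists_word_list {H : Subgroup (FreeGroup α)} (hH : H.FG) :
    ∃ L : List (Word α), wordSubgroup of L = H := by
  classical
  obtain ⟨T, rfl⟩ := hH
  refine ⟨T.toList.map toWord, congrArg Subgroup.closure (Set.ext fun g => ?_)⟩
  simp [wordVal_of, mk_toWord]

theorem finite_ordSpectrum_rightCoset {H : Subgroup (FreeGroup α)} (hH : H.FG) (u : FreeGroup α) :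
    (ordSpectrum (rightCoset H u)).Finite := by
  classical
  obtain ⟨L, rfl⟩ := exists_word_list hH
  rw [← mk_toWord (x := u)]
  exact (Set.finite_Iic _).subset (Set.range_subset_iff.2 fun g => relOrder_rightCoset_le L _ g)

theorem relOrder_rightCoset_of (L : List (Word α)) (u : Word α)
    (hi : (i, true) ∉ letters (invRev u :: L)) :
    relOrder (rightCoset (wordSubgroup of L) (mk u)) (of i) = 0 := by
  classical
  refine (relOrder_eq_zero_iff _ _).2 fun k hk hmem => hi ?_
  have hsub := toWord_subset_letters (rightCoset_subset_wordSubgroup L u hmem)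
  rw [toWord_of_pow] at hsub
  exact hsub (List.mem_replicate.2 ⟨Nat.one_le_iff_ne_zero.1 hk, rfl⟩)

theorem append_subset_letters {k : ℕ} (hk : 1 ≤ k) (hred : IsReduced (conjPow v c k))
    (h : mk (conjPow v c k) ∈ wordSubgroup of W) : v ++ c ⊆ letters W := by
  have hsub := subset_letters_of_mem_wordSubgroup hred h
  obtain ⟨k, rfl⟩ := Nat.exists_eq_add_of_le' hk
  rw [conjPow, List.replicate_succ, List.flatten_cons] at hsub
  simp only [List.append_subset] at hsub ⊢
  exact ⟨hsub.1, hsub.2.1.1⟩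

theorem exists_notMem_letters {w : Word α} (h : ¬ w ⊆ letters W) : ∃ i, (i, true) ∉ letters W := by
  contrapose! h
  rintro ⟨i, _ | _⟩ -
  exacts [inv_mem_letters (h i), h i]

/-- A bound for the lengths of words that realize all orders in a coset `H u`, when `H` is generated
by the words in `L` and `W` consists of `u⁻¹` and the words in `L`. -/
def witnessBound (W : List (Word α)) : ℕ :=
  3 * signatureBound (suffixes W).length (letters W).length

theorem signatureBound_mono_left {N N' M : ℕ} (h : N ≤ N') :
    signatureBound N M ≤ signatureBound N' M := by
  unfold signatureBound
  gcongr
  exact one_le_two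

/-- If some power of `v c v⁻¹` lies in the coset, then all its letters are letters of `u` or of `L`;
otherwise the order is `0`, and foreign letters have the same order. -/
theorem exists_short_relOrder_rightCoset_eq (L : List (Word α)) (u : Word α) (g : FreeGroup α) :
    (∃ w ∈ listsUpTo (letters (invRev u :: L)) (witnessBound (invRev u :: L)),
      relOrder (rightCoset (wordSubgroup of L) (mk u)) (mk w) =
        relOrder (rightCoset (wordSubgroup of L) (mk u)) g) ∨
    relOrder (rightCoset (wordSubgroup of L) (mk u)) g = 0 ∧
      ∃ i, (i, true) ∉ letters (invRev u :: L) := by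
  obtain ⟨v, c, rfl, hred⟩ := exists_conjPow g
  by_cases hvc : v ++ c ⊆ letters (invRev u :: L)
  · obtain ⟨Γ, x, y, hΓ, hx, hy, hcard, hcoset⟩ := exists_convex_finset L u
    obtain ⟨w, hw, hlen, horder⟩ := exists_short_relOrder_eq hΓ hx hy hred
      (invRev_letters_subset _) (List.append_subset.1 hvc).1 (List.append_subset.1 hvc).2
    rw [hcoset]
    refine .inl ⟨w, mem_listsUpTo.2 ⟨hlen.trans ?_, hw⟩, horder⟩
    exact Nat.mul_le_mul_left 3 (signatureBound_mono_left hcard)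
  · refine .inr ⟨(relOrder_eq_zero_iff _ _).2 fun k hk hmem => hvc ?_, exists_notMem_letters hvc⟩
    rw [mk_conjPow_one_pow] at hmem
    exact append_subset_letters hk (hred k hk) (rightCoset_subset_wordSubgroup L u hmem)

end CosetOrders

section Foldings

variable {α Q : Type*} {V W L : List (Word α)} {c : Word α → Q} {w : Word α}

/-- The last edge of the path with label `s`, as its letter, initial and final vertex, where the
vertices are words that label paths to them; inverse letters traverse an edge backwards. -/
def lastEdge : Word α → Option (α × Word α × Word α)
  | [] => none
  | (i, true) :: s => some (i, s, (i, true) :: s)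
  | (i, false) :: s => some (i, (i, false) :: s, s)

/-- The edges of the paths with labels in `V`, when `V` contains all suffixes of its words. -/
def edges (V : List (Word α)) : List (α × Word α × Word α) :=
  V.filterMap lastEdge

/-- The colouring `c` of the vertices is folded, in the sense of Stallings: two edges with the same
letter begin with the same colour exactly if they end with the same colour. -/
def IsFolded (V : List (Word α)) (c : Word α → Q) : Prop :=
  ∀ e ∈ edges V, ∀ e' ∈ edges V, e.1 = e'.1 → (c e.2.1 = c e'.2.1 ↔ c e.2.2 = c e'.2.2)

theorem exists_of_mem_edges {e : α × Word α × Word α} (he : e ∈ edges V) :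
    ∃ a s, a :: s ∈ V ∧ lastEdge (a :: s) = some e := by
  obtain ⟨_ | ⟨a, s⟩, hs, hlast⟩ := List.mem_filterMap.1 he
  · cases hlast
  · exact ⟨a, s, hs, hlast⟩

theorem mem_suffixes_of_mem_edges {e : α × Word α × Word α} (he : e ∈ edges (suffixes W)) :
    e.2.1 ∈ suffixes W ∧ e.2.2 ∈ suffixes W := by
  obtain ⟨⟨i, _ | _⟩, s, hs, hlast⟩ := exists_of_mem_edges he <;>
  obtain rfl := Option.some.inj hlast
  exacts [⟨hs, mem_suffixes_of_suffix hs (List.suffix_cons _ _)⟩,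
    ⟨mem_suffixes_of_suffix hs (List.suffix_cons _ _), hs⟩]

theorem of_mul_mk_of_mem_edges {e : α × Word α × Word α} (he : e ∈ edges V) :
    of e.1 * mk e.2.1 = mk e.2.2 := by
  obtain ⟨⟨i, _ | _⟩, s, -, hlast⟩ := exists_of_mem_edges he <;>
  obtain rfl := Option.some.inj hlast
  · exact Quot.sound Red.Step.cons_not
  · rfl

theorem isFolded_mk_smul {S : Type*} [MulAction (FreeGroup α) S] (V : List (Word α)) (x₀ : S) :
    IsFolded V fun s => mk s • x₀ := by
  rintro ⟨i, p, q⟩ he ⟨_, p', q'⟩ he' rfl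
  dsimp only
  rw [← of_mul_mk_of_mem_edges he, ← of_mul_mk_of_mem_edges he', mul_smul, mul_smul,
    smul_left_cancel_iff]

theorem IsFolded.congr {Q' : Type*} {c' : Word α → Q'} (h : IsFolded (suffixes W) c)
    (hc : ∀ s ∈ suffixes W, ∀ t ∈ suffixes W, c' s = c' t ↔ c s = c t) :
    IsFolded (suffixes W) c' := by
  intro e he e' he' heq
  obtain ⟨hp, hq⟩ := mem_suffixes_of_mem_edges he
  obtain ⟨hp', hq'⟩ := mem_suffixes_of_mem_edges he'
  rw [hc _ hp _ hp', hc _ hq _ hq', h e he e' he' heq]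

theorem exists_perm_extend (E : List (Q × Q))
    (hE : ∀ e ∈ E, ∀ e' ∈ E, e.1 = e'.1 ↔ e.2 = e'.2) :
    ∃ σ : Equiv.Perm Q, ∀ e ∈ E, σ e.1 = e.2 := by
  classical
  let s : Set Q := {p | ∃ e ∈ E, e.1 = p}
  have hs : s.Finite := (E.map Prod.fst).finite_toSet.subset fun p hp => List.mem_map.2 hp
  choose e heE he using fun p : s => p.2
  let f : s ↪ Q := ⟨fun p => (e p).2, fun p p' h => Subtype.ext (by
    rw [← he p, ← he p', hE _ (heE p) _ (heE p')]
    exact h)⟩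
  obtain ⟨σ, hσ⟩ : ∃ σ : Q ≃ Q, ∀ p : s, σ p = f p := by
    rcases finite_or_infinite Q
    · exact Cardinal.extend_function_finite f ⟨Equiv.refl Q⟩
    · exact Cardinal.extend_function_of_lt f
        ((Cardinal.lt_aleph0_iff_set_finite.2 hs).trans_le (Cardinal.aleph0_le_mk Q))
        ⟨Equiv.refl Q⟩
  refine ⟨σ, fun d hd => ?_⟩
  have hdom : d.1 ∈ s := ⟨d, hd, rfl⟩
  exact (hσ ⟨d.1, hdom⟩).trans ((hE _ (heE _) _ hd).1 (he _))

/-- This is Marshall Hall's completion of a finite folded graph to a covering. -/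
theorem IsFolded.exists_lift_mk_eq (h : IsFolded (suffixes W) c) :
    ∃ σ : α → Equiv.Perm Q, ∀ s ∈ suffixes W, lift σ (mk s) (c []) = c s := by
  classical
  have hletter (i : α) : ∃ σ : Equiv.Perm Q,
      ∀ e ∈ edges (suffixes W), e.1 = i → σ (c e.2.1) = c e.2.2 := by
    obtain ⟨σ, hσ⟩ := exists_perm_extend
      (((edges (suffixes W)).filter (·.1 = i)).map fun e => (c e.2.1, c e.2.2)) (by
        simp only [List.forall_mem_map, List.mem_filter, decide_eq_true_eq]
        rintro e ⟨he, rfl⟩ e' ⟨he', hi⟩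
        exact h e he e' he' hi.symm)
    simp only [List.forall_mem_map, List.mem_filter, decide_eq_true_eq] at hσ
    exact ⟨σ, fun e he hi => hσ e ⟨he, hi⟩⟩
  choose σ hσ using hletter
  refine ⟨σ, fun s hs => ?_⟩
  induction s with
  | nil => rw [← one_eq_mk, _root_.map_one, Equiv.Perm.one_apply]
  | cons a s ih =>
    have hsplit : mk (a :: s) = mk [a] * mk s := by rw [mul_mk, List.singleton_append]
    rw [hsplit, _root_.map_mul, Equiv.Perm.mul_apply,
      ih (mem_suffixes_of_suffix hs (List.suffix_cons _ _)), lift_mk]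
    have hedge {e} (he : lastEdge (a :: s) = some e) : σ e.1 (c e.2.1) = c e.2.2 :=
      hσ e.1 e (List.mem_filterMap.2 ⟨_, hs, he⟩) rfl
    obtain ⟨i, _ | _⟩ := a
    · simpa [Equiv.symm_apply_eq] using (hedge rfl).symm
    · simpa using hedge rfl

theorem IsFolded.eq_of_mk_mem (h : IsFolded (suffixes W) c) (hLW : L ⊆ W)
    (hL : ∀ v ∈ L, c v = c []) (hw : w ∈ W) (hmem : mk w ∈ wordSubgroup of L) : c w = c [] := by
  obtain ⟨σ, hσ⟩ := h.exists_lift_mk_eq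
  have hle : wordSubgroup of L ≤ (MulAction.stabilizer (Equiv.Perm Q) (c [])).comap (lift σ) := by
    refine (Subgroup.closure_le _).2 ?_
    rintro _ ⟨v, hv, rfl⟩
    rw [wordVal_of]
    exact (hσ v (subset_suffixes (hLW hv))).trans (hL v hv)
  rw [← hσ w (subset_suffixes hw)]
  exact hle hmem

end Foldings

section Tables

variable {β Q : Type*} [DecidableEq β]

/-- The colouring of the entries of `V` by the corresponding entries of `t`. -/
def tableColor (V : List β) (t : List ℕ) (b : β) : ℕ :=
  t.getD (V.idxOf b) 0

theorem exists_tableColor_eq_iff (V : List β) (f : β → Q) :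
    ∃ t ∈ listsUpTo (List.range V.length) V.length,
      ∀ a ∈ V, ∀ b ∈ V, tableColor V t a = tableColor V t b ↔ f a = f b := by
  classical
  let t := V.map fun a => (V.map f).idxOf (f a)
  have hmem {a} (ha : a ∈ V) : f a ∈ V.map f := List.mem_map_of_mem ha
  have hcolor {a} (ha : a ∈ V) : tableColor V t a = (V.map f).idxOf (f a) := by
    have hlt := List.idxOf_lt_length_of_mem ha
    rw [tableColor, List.getD_eq_getElem _ _ (by simpa [t] using hlt), List.getElem_map,
      List.getElem_idxOf]
  refine ⟨t, mem_listsUpTo.2 ⟨(List.length_map _).le, ?_⟩, fun a ha b hb => ?_⟩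
  · simp only [t, List.subset_def, List.mem_map, List.mem_range]
    rintro _ ⟨a, ha, rfl⟩
    simpa using List.idxOf_lt_length_of_mem (hmem ha)
  · rw [hcolor ha, hcolor hb, List.idxOf_inj (hmem ha)]

end Tables

section Membership

variable {α : Type*} [DecidableEq α]

/-- In each folded colouring of the paths labelled by `w` and the words in `L` such that the paths
labelled by the words in `L` are loops, the path labelled by `w` is a loop. As there are no more
colours needed than vertices, this is a finite test. -/
def MembershipTest (L : List (Word α)) (w : Word α) : Prop :=
  ∀ t ∈ listsUpTo (List.range (suffixes (w :: L)).length) (suffixes (w :: L)).length,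
    IsFolded (suffixes (w :: L)) (tableColor (suffixes (w :: L)) t) →
    (∀ v ∈ L, tableColor (suffixes (w :: L)) t v = tableColor (suffixes (w :: L)) t []) →
    tableColor (suffixes (w :: L)) t w = tableColor (suffixes (w :: L)) t []

theorem membershipTest_iff {L : List (Word α)} {w : Word α} :
    MembershipTest L w ↔ mk w ∈ wordSubgroup of L := by
  constructor
  · intro h
    let f : Word α → FreeGroup α ⧸ wordSubgroup of L := fun s => mk s • ↑(1 : FreeGroup α)
    have hf {v : Word α} : f v = f [] ↔ mk v ∈ wordSubgroup of L := by
      conv_rhs =>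
        rw [← MulAction.stabilizer_quotient (wordSubgroup of L), MulAction.mem_stabilizer_iff]
      simp only [f, ← one_eq_mk, one_smul]
    obtain ⟨t, ht, hker⟩ := exists_tableColor_eq_iff (suffixes (w :: L)) f
    have hloop {v} (hv : v ∈ w :: L) := hker v (subset_suffixes hv) [] nil_mem_suffixes
    rw [← hf, ← hloop List.mem_cons_self]
    refine h t ht ((isFolded_mk_smul _ _).congr hker) fun v hv => ?_
    rw [hloop (List.mem_cons_of_mem _ hv), hf]
    exact mk_mem_wordSubgroup hv
  · exact fun hw t _ hfolded hL =>
      hfolded.eq_of_mk_mem (List.subset_cons_self w L) hL List.mem_cons_self hw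

end Membership

section Algorithms

variable {α : Type*} [DecidableEq α]

/-- The `k`-th power of `w` is found to lie in the coset `H u`, for the input `p = (L, u, w)` and
the subgroup `H` generated by the words in `L`. -/
def CosetTest (p : List (Word α) × Word α × Word α) (k : ℕ) : Prop :=
  1 ≤ k ∧ MembershipTest p.1 ((List.replicate k p.2.2).flatten ++ invRev p.2.1)

theorem cosetTest_iff {L : List (Word α)} {u w : Word α} {k : ℕ} :
    CosetTest (L, u, w) k ↔ 1 ≤ k ∧ mk w ^ k ∈ rightCoset (wordSubgroup of L) (mk u) := by
  rw [CosetTest, membershipTest_iff, mem_rightCoset_iff, ← mul_mk, mk_flatten_replicate, inv_mk]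

open Classical in
/-- The order of `w` in the coset `H u`, for the input `p = (L, u, w)` and the subgroup `H`
generated by the words in `L`, found by testing all exponents that are possible orders. -/
noncomputable def cosetOrder (p : List (Word α) × Word α × Word α) : ℕ :=
  ((List.range ((suffixes (invRev p.2.1 :: p.1)).length + 1)).filter (CosetTest p)).headI

theorem ListsSet.headI_eq_sInf {l : List ℕ} {A : Set ℕ} (h : ListsSet l A) : l.headI = sInf A := by
  obtain ⟨hsorted, hmem⟩ := h
  cases l with
  | nil =>
    have hA : A = ∅ := Set.eq_empty_of_forall_notMem fun k hk => List.not_mem_nil ((hmem k).2 hk)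
    rw [hA, Nat.sInf_empty]
    rfl
  | cons m l =>
    refine (IsLeast.csInf_eq ⟨(hmem m).1 List.mem_cons_self, fun k hk => ?_⟩).symm
    rcases List.mem_cons.1 ((hmem k).2 hk) with rfl | hkl
    exacts [le_rfl, (List.rel_of_pairwise_cons hsorted hkl).le]

theorem sInf_inter_Iic {A : Set ℕ} {N : ℕ} (hN : sInf A ≤ N) : sInf (A ∩ Set.Iic N) = sInf A := by
  rcases A.eq_empty_or_nonempty with rfl | hA
  · rw [Set.empty_inter]
  · exact IsLeast.csInf_eq ⟨⟨Nat.sInf_mem hA, hN⟩, fun k hk => Nat.sInf_le hk.1⟩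

theorem cosetOrder_eq (L : List (Word α)) (u w : Word α) :
    cosetOrder (L, u, w) = relOrder (rightCoset (wordSubgroup of L) (mk u)) (mk w) := by
  have hle := relOrder_rightCoset_le L u (mk w)
  simp only [relOrder, ← cosetTest_iff] at hle ⊢
  rw [← sInf_inter_Iic hle]
  refine ListsSet.headI_eq_sInf ⟨List.Pairwise.filter _ List.pairwise_lt_range, fun k => ?_⟩
  simp only [List.mem_filter, List.mem_range, Nat.lt_succ_iff, decide_eq_true_eq, and_comm,
    Set.mem_inter_iff, Set.mem_ofPred_eq, Set.mem_Iic]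

open Classical in
/-- The orders in the coset `H u` in increasing order, for the input `p = (L, u)` and the subgroup
`H` generated by the words in `L`. -/
noncomputable def cosetSpectrum (p : List (Word α) × Word α) : List ℕ :=
  (List.range ((suffixes (invRev p.2 :: p.1)).length + 1)).filter fun k =>
    (∃ w ∈ listsUpTo (letters (invRev p.2 :: p.1)) (witnessBound (invRev p.2 :: p.1)),
      cosetOrder (p.1, p.2, w) = k) ∨
    k = 0 ∧ ∃ i, (i, true) ∉ letters (invRev p.2 :: p.1)

theorem listsSet_cosetSpectrum (L : List (Word α)) (u : Word α) :
    ListsSet (cosetSpectrum (L, u))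
      (ordSpectrum (rightCoset (wordSubgroup of L) (mk u))) := by
  refine ⟨List.Pairwise.filter _ List.pairwise_lt_range, fun k => ?_⟩
  simp only [cosetSpectrum, cosetOrder_eq, List.mem_filter, List.mem_range, Nat.lt_succ_iff,
    decide_eq_true_eq]
  constructor
  · rintro ⟨-, ⟨w, -, rfl⟩ | ⟨rfl, i, hi⟩⟩
    exacts [⟨mk w, rfl⟩, ⟨of i, relOrder_rightCoset_of L u hi⟩]
  · rintro ⟨g, rfl⟩
    exact ⟨relOrder_rightCoset_le L u g, exists_short_relOrder_rightCoset_eq L u g⟩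

end Algorithms

section Primrec

open Primrec

variable {β : Type*} [Primcodable β]

theorem primrecPred_imp {p q : β → Prop} (hp : PrimrecPred p) (hq : PrimrecPred q) :
    PrimrecPred fun b => p b → q b :=
  (hp.not.or hq).of_eq fun _ => imp_iff_not_or.symm

theorem primrecPred_iff {p q : β → Prop} (hp : PrimrecPred p) (hq : PrimrecPred q) :
    PrimrecPred fun b => p b ↔ q b :=
  ((primrecPred_imp hp hq).and (primrecPred_imp hq hp)).of_eq fun _ =>
    iff_iff_implies_and_implies.symm

theorem primrec_listsUpTo : Primrec₂ (listsUpTo : List β → ℕ → List (List β)) := by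
  have hcons : Primrec₂ fun (q : List β × ℕ × List (List β)) (b : β) => q.2.2.map (b :: ·) :=
    list_map (snd.comp (snd.comp fst)) (list_cons.comp (snd.comp fst) snd).to₂
  have hstep : Primrec₂ fun (B : List β) (q : ℕ × List (List β)) =>
      [] :: B.flatMap fun b => q.2.map (b :: ·) :=
    (list_cons.comp (const _) (list_flatMap fst hcons)).to₂
  refine (nat_rec (const [[]]) hstep).of_eq fun B k => ?_
  induction k with
  | zero => rfl
  | succ k ih => simp only [listsUpTo, ← ih]

theorem primrec_flatten_replicate :
    Primrec₂ fun (w : List β) (k : ℕ) => (List.replicate k w).flatten := by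
  have hstep : Primrec₂ fun (w : List β) (q : ℕ × List β) => w ++ q.2 :=
    (list_append.comp fst (snd.comp snd)).to₂
  refine (nat_rec (const []) hstep).of_eq fun w k => ?_
  induction k with
  | zero => rfl
  | succ k ih => rw [List.replicate_succ, List.flatten_cons, ← ih]

theorem primrec_two_pow : Primrec fun k : ℕ => 2 ^ k := by
  have hstep : Primrec₂ fun _ r : ℕ => 2 * r := (nat_mul.comp (const 2) snd).to₂
  refine (nat_rec₁ 1 hstep).of_eq fun k => ?_
  induction k with
  | zero => rfl
  | succ k ih => rw [pow_succ', ← ih]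

theorem primrec_signatureBound : Primrec₂ signatureBound := by
  have hM : Primrec fun p : ℕ × ℕ => p.2 + 1 := succ.comp snd
  exact nat_mul.comp (primrec_two_pow.comp (nat_mul.comp fst fst))
    (nat_mul.comp hM (nat_mul.comp hM (const 2)))

theorem primrec_tails : Primrec (List.tails : List β → List (List β)) := by
  have hstep : Primrec₂ fun (_ : List β) (q : β × List β × List (List β)) =>
      (q.1 :: q.2.1) :: q.2.2 :=
    (list_cons.comp (list_cons.comp (fst.comp snd) (fst.comp (snd.comp snd)))
      (snd.comp (snd.comp snd))).to₂
  refine (list_rec Primrec.id (const [[]]) hstep).of_eq fun l => ?_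
  induction l with
  | nil => rfl
  | cons b l ih => simp only [List.tails, ← ih, id]

theorem primrec_tableColor [DecidableEq β] :
    Primrec fun p : (List β × List ℕ) × β => tableColor p.1.1 p.1.2 p.2 :=
  (list_getD 0).comp (snd.comp fst) (list_idxOf.comp snd (fst.comp fst))

variable {α : Type*} [Primcodable α]

theorem primrec_suffixes : Primrec (suffixes : List (Word α) → List (Word α)) :=
  list_cons.comp (const []) (list_flatMap Primrec.id (primrec_tails.comp snd).to₂)

theorem primrec_invRev : Primrec (invRev : Word α → Word α) :=
  list_reverse.comp (list_map Primrec.id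
    (Primrec.pair (fst.comp snd) (Primrec.not.comp (snd.comp snd))).to₂)

theorem primrec_letters : Primrec (letters : List (Word α) → List (α × Bool)) :=
  list_append.comp list_flatten (primrec_invRev.comp list_flatten)

theorem primrec_witnessBound : Primrec (witnessBound : List (Word α) → ℕ) :=
  nat_mul.comp (const 3) (primrec_signatureBound.comp (list_length.comp primrec_suffixes)
    (list_length.comp primrec_letters))

theorem primrec_lastEdge : Primrec (lastEdge : Word α → Option (α × Word α × Word α)) := by
  have hcons : Primrec fun p : Word α × (α × Bool) × Word α => p.2.1 :: p.2.2 :=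
    list_cons.comp (fst.comp snd) (snd.comp snd)
  have hletter : Primrec fun p : Word α × (α × Bool) × Word α => p.2.1.1 :=
    fst.comp (fst.comp snd)
  have hstep : Primrec₂ fun (_ : Word α) (q : (α × Bool) × Word α) =>
      bif q.1.2 then some (q.1.1, q.2, q.1 :: q.2) else some (q.1.1, q.1 :: q.2, q.2) :=
    (Primrec.cond (snd.comp (fst.comp snd))
      (option_some.comp (hletter.pair ((snd.comp snd).pair hcons)))
      (option_some.comp (hletter.pair (hcons.pair (snd.comp snd))))).to₂
  refine (list_casesOn Primrec.id (const none) hstep).of_eq fun s => ?_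
  obtain _ | ⟨⟨i, _ | _⟩, s⟩ := s <;> rfl

theorem primrec_edges : Primrec (edges : List (Word α) → List (α × Word α × Word α)) :=
  listFilterMap Primrec.id (primrec_lastEdge.comp snd).to₂

theorem primrecPred_exists_notMem_letters :
    PrimrecPred fun W : List (Word α) => ∃ i, (i, true) ∉ letters W := by
  cases finite_or_infinite α
  · have := Fintype.ofFinite α
    have hletter : PrimrecRel fun (i : α) (W : List (Word α)) => (i, true) ∉ letters W :=
      (primrecRel_mem_list.comp (primrec_letters.comp snd) (fst.pair (const true))).not
    exact (hletter.exists_mem_list.comp (const Finset.univ.toList) Primrec.id).of_eq fun W => by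
      simp only [Finset.mem_toList, Finset.mem_univ, true_and, id]
  · refine PrimrecPred.of_eq ⟨fun _ => isTrue trivial, const true⟩ fun W => iff_of_true trivial ?_
    obtain ⟨i, hi⟩ := ((letters W).map Prod.fst).finite_toSet.exists_notMem
    exact ⟨i, fun hmem => hi (List.mem_map_of_mem (f := Prod.fst) hmem)⟩

variable [DecidableEq α]

theorem primrecRel_isFolded_tableColor :
    PrimrecRel fun (V : List (Word α)) (t : List ℕ) => IsFolded V (tableColor V t) := by
  have hstart : Primrec fun e : α × Word α × Word α => e.2.1 := fst.comp snd
  have hend : Primrec fun e : α × Word α × Word α => e.2.2 := snd.comp snd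
  have hcolor {f : (α × Word α × Word α) × (α × Word α × Word α) × List (Word α) × List ℕ → Word α}
      (hf : Primrec f) : Primrec fun q => tableColor q.2.2.1 q.2.2.2 (f q) :=
    primrec_tableColor.comp ((snd.comp snd).pair hf)
  have hedges : PrimrecRel fun (e' : α × Word α × Word α)
      (q : (α × Word α × Word α) × List (Word α) × List ℕ) => q.1.1 = e'.1 →
        (tableColor q.2.1 q.2.2 q.1.2.1 = tableColor q.2.1 q.2.2 e'.2.1 ↔
          tableColor q.2.1 q.2.2 q.1.2.2 = tableColor q.2.1 q.2.2 e'.2.2) :=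
    primrecPred_imp (Primrec.eq.comp (fst.comp (fst.comp snd)) (fst.comp fst)) <|
      primrecPred_iff
        (Primrec.eq.comp (hcolor (hstart.comp (fst.comp snd))) (hcolor (hstart.comp fst)))
        (Primrec.eq.comp (hcolor (hend.comp (fst.comp snd))) (hcolor (hend.comp fst)))
  have hedge : PrimrecRel fun (e : α × Word α × Word α) (q : List (Word α) × List ℕ) =>
      ∀ e' ∈ edges q.1, e.1 = e'.1 →
        (tableColor q.1 q.2 e.2.1 = tableColor q.1 q.2 e'.2.1 ↔
          tableColor q.1 q.2 e.2.2 = tableColor q.1 q.2 e'.2.2) :=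
    hedges.forall_mem_list.comp (primrec_edges.comp (fst.comp snd)) Primrec.id
  exact hedge.forall_mem_list.comp (primrec_edges.comp fst) Primrec.id

theorem primrecRel_membershipTest : PrimrecRel (MembershipTest (α := α)) := by
  have hV : Primrec fun p : List (Word α) × Word α => suffixes (p.2 :: p.1) :=
    primrec_suffixes.comp (list_cons.comp snd fst)
  have hloop : PrimrecRel fun (v : Word α) (q : List ℕ × List (Word α) × Word α) =>
      tableColor (suffixes (q.2.2 :: q.2.1)) q.1 v =
        tableColor (suffixes (q.2.2 :: q.2.1)) q.1 [] := by
    have hcolor {f : Word α × List ℕ × List (Word α) × Word α → Word α} (hf : Primrec f) :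
        Primrec fun q => tableColor (suffixes (q.2.2.2 :: q.2.2.1)) q.2.1 (f q) :=
      primrec_tableColor.comp (((hV.comp (snd.comp snd)).pair (fst.comp snd)).pair hf)
    exact Primrec.eq.comp (hcolor fst) (hcolor (const []))
  have htable : PrimrecRel fun (t : List ℕ) (p : List (Word α) × Word α) =>
      IsFolded (suffixes (p.2 :: p.1)) (tableColor (suffixes (p.2 :: p.1)) t) →
      (∀ v ∈ p.1, tableColor (suffixes (p.2 :: p.1)) t v =
        tableColor (suffixes (p.2 :: p.1)) t []) →
      tableColor (suffixes (p.2 :: p.1)) t p.2 = tableColor (suffixes (p.2 :: p.1)) t [] :=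
    primrecPred_imp (primrecRel_isFolded_tableColor.comp (hV.comp snd) fst) <|
      primrecPred_imp (hloop.forall_mem_list.comp (fst.comp snd) Primrec.id)
        (hloop.comp (snd.comp snd) Primrec.id)
  have hN := list_length.comp hV
  exact htable.forall_mem_list.comp (primrec_listsUpTo.comp (list_range.comp hN) hN) Primrec.id

theorem primrecRel_cosetTest : PrimrecRel (CosetTest (α := α)) := by
  refine PrimrecPred.and (nat_le.comp (const 1) snd)
    (primrecRel_membershipTest.comp (fst.comp fst) ?_)
  exact list_append.comp (primrec_flatten_replicate.comp (snd.comp (snd.comp fst)) snd)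
    (primrec_invRev.comp (fst.comp (snd.comp fst)))

theorem primrec_cosetOrder : Primrec (cosetOrder (α := α)) := by
  classical
  have htest : PrimrecRel fun (k : ℕ) (p : List (Word α) × Word α × Word α) => CosetTest p k :=
    primrecRel_cosetTest.comp snd fst
  have hV : Primrec fun p : List (Word α) × Word α × Word α => invRev p.2.1 :: p.1 :=
    list_cons.comp (primrec_invRev.comp (fst.comp snd)) fst
  exact list_headI.comp (htest.listFilter.comp
    (list_range.comp (succ.comp (list_length.comp (primrec_suffixes.comp hV)))) Primrec.id)

theorem primrec_cosetSpectrum : Primrec (cosetSpectrum (α := α)) := by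
  classical
  have hV : Primrec fun p : List (Word α) × Word α => invRev p.2 :: p.1 :=
    list_cons.comp (primrec_invRev.comp snd) fst
  have horder : PrimrecRel fun (w : Word α) (q : ℕ × List (Word α) × Word α) =>
      cosetOrder (q.2.1, q.2.2, w) = q.1 :=
    Primrec.eq.comp (primrec_cosetOrder.comp
      ((fst.comp (snd.comp snd)).pair ((snd.comp (snd.comp snd)).pair fst))) (fst.comp snd)
  have hspectrum : PrimrecRel fun (k : ℕ) (p : List (Word α) × Word α) =>
      (∃ w ∈ listsUpTo (letters (invRev p.2 :: p.1)) (witnessBound (invRev p.2 :: p.1)),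
        cosetOrder (p.1, p.2, w) = k) ∨
      k = 0 ∧ ∃ i, (i, true) ∉ letters (invRev p.2 :: p.1) :=
    (horder.exists_mem_list.comp (primrec_listsUpTo.comp (primrec_letters.comp (hV.comp snd))
      (primrec_witnessBound.comp (hV.comp snd))) Primrec.id).or
    ((Primrec.eq.comp fst (const 0)).and
      (primrecPred_exists_notMem_letters.comp (hV.comp snd)))
  exact hspectrum.listFilter.comp
    (list_range.comp (succ.comp (list_length.comp (primrec_suffixes.comp hV)))) Primrec.id

end Primrec

section Main

variable {α : Type*} [Primcodable α]

theorem cosetOrderComputable_of : CosetOrderComputable (of : α → FreeGroup α) := by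
  classical
  exact ⟨cosetOrder, primrec_cosetOrder.to_comp, fun L u w => by
    rw [cosetOrder_eq, wordVal_of, wordVal_of]⟩

theorem cosetSpectrumComputable_of : CosetSpectrumComputable (of : α → FreeGroup α) := by
  classical
  exact ⟨cosetSpectrum, primrec_cosetSpectrum.to_comp, fun L u => by
    rw [wordVal_of]
    exact listsSet_cosetSpectrum L u⟩

theorem mainTheorem8_general (α : Type*) [Primcodable α] :
    CosetOrderComputable (of : α → FreeGroup α) ∧
    (∀ H : Subgroup (FreeGroup α), H.FG → ∀ u : FreeGroup α,
      (ordSpectrum (rightCoset H u)).Finite) ∧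
    CosetSpectrumComputable (of : α → FreeGroup α) ∧
    OrderProblem (of : α → FreeGroup α) ∧
    TorsionProblem (of : α → FreeGroup α) ∧
    FiniteSpectrumProblem (of : α → FreeGroup α) ∧
    SpectrumMembershipProblem (of : α → FreeGroup α) ∧
    TorsionGroupProblem (of : α → FreeGroup α) ∧
    PurityProblem (of : α → FreeGroup α) := by
  have horder : CosetOrderComputable (of : α → FreeGroup α) := cosetOrderComputable_of
  have hspectrum : CosetSpectrumComputable (of : α → FreeGroup α) := cosetSpectrumComputable_of
  exact ⟨horder, fun H hH u => finite_ordSpectrum_rightCoset hH u, hspectrum, horder.orderProblem,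
    horder.orderProblem.torsionProblem, hspectrum.finiteSpectrumProblem,
    hspectrum.spectrumMembershipProblem, hspectrum.torsionGroupProblem, hspectrum.purityProblem⟩

end Main

end RelativeOrder

theorem mainTheorem8 (n : ℕ) :
    RelativeOrder.CosetOrderComputable (FreeGroup.of : Fin n → FreeGroup (Fin n)) ∧
    (∀ H : Subgroup (FreeGroup (Fin n)), H.FG → ∀ u : FreeGroup (Fin n),
      (RelativeOrder.ordSpectrum (RelativeOrder.rightCoset H u)).Finite) ∧
    RelativeOrder.CosetSpectrumComputable (FreeGroup.of : Fin n → FreeGroup (Fin n)) ∧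
    RelativeOrder.OrderProblem (FreeGroup.of : Fin n → FreeGroup (Fin n)) ∧
    RelativeOrder.TorsionProblem (FreeGroup.of : Fin n → FreeGroup (Fin n)) ∧
    RelativeOrder.FiniteSpectrumProblem (FreeGroup.of : Fin n → FreeGroup (Fin n)) ∧
    RelativeOrder.SpectrumMembershipProblem (FreeGroup.of : Fin n → FreeGroup (Fin n)) ∧
    RelativeOrder.TorsionGroupProblem (FreeGroup.of : Fin n → FreeGroup (Fin n)) ∧
    RelativeOrder.PurityProblem (FreeGroup.of : Fin n → FreeGroup (Fin n)) :=
  RelativeOrder.mainTheorem8_general (Fin n)
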